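/- Let $A$ and $B$ be complex Banach algebras (not necessarily unital), let $n\ge 2$, and let $\varphi:A\to B$ be a continuous $n$-homomorphism, i.e. a continuous linear map with $\varphi(a_1a_2\cdots a_n)=\varphi(a_1)\varphi(a_2)\cdots\varphi(a_n)$ for all $a_1,\dots,a_n\in A$. Equip the second duals $A^{**}$ and $B^{**}$ with their first Arens products, where for $F,G\in A^{**}$, $f\in A^*$, $a,b\in A$, $$(FG)(f)=F(G\cdot f),\qquad (G\cdot f)(a)=G(f\cdot a),\qquad (f\cdot a)(b)=f(ab).$$ Let $i_A:A\to A^{**}$ and $i_B:B\to B^{**}$ be the canonical embeddings. Then the second adjoint $\varphi^{**}:A^{**}\to B^{**}$, $\varphi^{**}(F)(g)=F(g\circ\varphi)$, is also an $n$-homomorphism. Suppose in addition that $A$ is Arens regular, i.e. the first Arens product on $A^{**}$ coincides with the second one, $(F\diamond G)(f)=G(f\cdot F)$ with $(f\cdot F)(a)=F(a\cdot f)$ and $(a\cdot f)(b)=f(ba)$, and that $A$ has a bounded two-sided approximate identity. Then $A^{**}$ has an identity element $E$, and there is an algebra homomorphism $\psi:A^{**}\to B^{**}$ with $\varphi^{**}(F)=\varphi^{**}(E)\,\psi(F)$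 for all $F\in A^{**}$; in particular $$i_B(\varphi(a))=\varphi^{**}(E)\,\psi(i_A(a))\qquad\text{for all } a\in A,$$ so that $\varphi$, viewed as a map into $B^{**}$, is a multiple of a homomorphism. -/

import Mathlib

set_option maxSynthPendingDepth 3

open ContinuousLinearMap

noncomputable section

/-- The Arens adjoint of a bounded bilinear map `m : X × Y → Z`: the bounded bilinear map
`Z* × X → Y*`, `(f, x) ↦ (y ↦ f (m x y))`. -/
def arensAdjoint {X Y Z : Type*} [NormedAddCommGroup X] [NormedSpace ℂ X]
    [NormedAddCommGroup Y] [NormedSpace ℂ Y] [NormedAddCommGroup Z] [NormedSpace ℂ Z]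
    (m : X →L[ℂ] Y →L[ℂ] Z) : StrongDual ℂ Z →L[ℂ] X →L[ℂ] StrongDual ℂ Y :=
  ((compL ℂ X (Y →L[ℂ] Z) (StrongDual ℂ Y)).flip m).comp (compL ℂ Y Z ℂ)

theorem arensAdjoint_apply {X Y Z : Type*} [NormedAddCommGroup X] [NormedSpace ℂ X]
    [NormedAddCommGroup Y] [NormedSpace ℂ Y] [NormedAddCommGroup Z] [NormedSpace ℂ Z]
    (m : X →L[ℂ] Y →L[ℂ] Z) (f : StrongDual ℂ Z) (x : X) (y : Y) :
    arensAdjoint m f x y = f (m x y) := rfl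

theorem norm_arensAdjoint_le {X Y Z : Type*} [NormedAddCommGroup X] [NormedSpace ℂ X]
    [NormedAddCommGroup Y] [NormedSpace ℂ Y] [NormedAddCommGroup Z] [NormedSpace ℂ Z]
    (m : X →L[ℂ] Y →L[ℂ] Z) : ‖arensAdjoint m‖ ≤ ‖m‖ := by
  refine opNorm_le_bound _ (norm_nonneg _) fun f => ?_
  refine opNorm_le_bound _ (by positivity) fun x => ?_
  refine opNorm_le_bound _ (by positivity) fun y => ?_
  calc ‖f (m x y)‖ ≤ ‖f‖ * ‖m x y‖ := f.le_opNorm _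
    _ ≤ ‖f‖ * (‖m‖ * ‖x‖ * ‖y‖) := by gcongr; exact m.le_opNorm₂ x y
    _ = ‖m‖ * ‖f‖ * ‖x‖ * ‖y‖ := by ring

section Products

variable (A : Type*) [NonUnitalNormedRing A] [NormedSpace ℂ A] [IsScalarTower ℂ A A]
  [SMulCommClass ℂ A A]

/-- The first Arens product on `A**`: `(F □ G)(f) = F (G · f)`, where `(G · f)(a) = G (f · a)` and
`(f · a)(b) = f (a * b)`. -/
def arensFirst : StrongDual ℂ (StrongDual ℂ A) →L[ℂ] StrongDual ℂ (StrongDual ℂ A) →L[ℂ]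
    StrongDual ℂ (StrongDual ℂ A) :=
  arensAdjoint (arensAdjoint (arensAdjoint (ContinuousLinearMap.mul ℂ A)))

/-- The second Arens product on `A**`: `(F ◇ G)(f) = G (f · F)`, where `(f · F)(a) = F (a · f)` and
`(a · f)(b) = f (b * a)`. -/
def arensSecond : StrongDual ℂ (StrongDual ℂ A) →L[ℂ] StrongDual ℂ (StrongDual ℂ A) →L[ℂ]
    StrongDual ℂ (StrongDual ℂ A) :=
  (arensAdjoint (arensAdjoint (arensAdjoint (ContinuousLinearMap.mul ℂ A).flip))).flip

/-- `A` is Arens regular if the two Arens products on `A**` coincide. -/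
def ArensRegular : Prop :=
  ∀ F G : StrongDual ℂ (StrongDual ℂ A), arensFirst A F G = arensSecond A F G

end Products

/-- The second dual `A**`, as a Banach algebra under the first Arens product. -/
def SecondDual (A : Type*) [NonUnitalNormedRing A] [NormedSpace ℂ A] : Type _ :=
  StrongDual ℂ (StrongDual ℂ A)

namespace SecondDual

section Instances

variable {A : Type*} [NonUnitalNormedRing A] [NormedSpace ℂ A]

instance : NormedAddCommGroup (SecondDual A) :=
  inferInstanceAs (NormedAddCommGroup (StrongDual ℂ (StrongDual ℂ A)))

instance : NormedSpace ℂ (SecondDual A) :=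
  inferInstanceAs (NormedSpace ℂ (StrongDual ℂ (StrongDual ℂ A)))

instance : CompleteSpace (SecondDual A) :=
  inferInstanceAs (CompleteSpace (StrongDual ℂ (StrongDual ℂ A)))

variable [IsScalarTower ℂ A A] [SMulCommClass ℂ A A]

instance : Mul (SecondDual A) := ⟨fun F G => arensFirst A F G⟩

theorem arens_assoc (F G H : StrongDual ℂ (StrongDual ℂ A)) :
    arensFirst A (arensFirst A F G) H = arensFirst A F (arensFirst A G H) := by
  refine ContinuousLinearMap.ext fun f => congrArg F ?_
  refine ContinuousLinearMap.ext fun a => congrArg G ?_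
  refine ContinuousLinearMap.ext fun b => congrArg H ?_
  refine ContinuousLinearMap.ext fun c => congrArg f ?_
  exact mul_assoc a b c

theorem norm_arens_le (F G : SecondDual A) : ‖F * G‖ ≤ ‖F‖ * ‖G‖ := by
  have h1 : ‖arensFirst A‖ ≤ 1 :=
    ((norm_arensAdjoint_le _).trans (norm_arensAdjoint_le _)).trans
      ((norm_arensAdjoint_le _).trans (opNorm_mul_le ℂ A))
  calc ‖arensFirst A F G‖ ≤ ‖arensFirst A‖ * ‖F‖ * ‖G‖ := (arensFirst A).le_opNorm₂ F G
    _ ≤ 1 * ‖F‖ * ‖G‖ := by gcongr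
    _ = ‖F‖ * ‖G‖ := by rw [one_mul]

instance : NonUnitalNormedRing (SecondDual A) where
  __ := (inferInstance : NormedAddCommGroup (SecondDual A))
  mul := (· * ·)
  left_distrib F G H := (arensFirst A F).map_add G H
  right_distrib F G H := (arensFirst A).map_add₂ F G H
  zero_mul F := (arensFirst A).map_zero₂ F
  mul_zero F := (arensFirst A F).map_zero
  mul_assoc := arens_assoc
  norm_mul_le := norm_arens_le

instance : IsScalarTower ℂ (SecondDual A) (SecondDual A) :=
  ⟨fun c F G => (arensFirst A).map_smul₂ c F G⟩

instance : SMulCommClass ℂ (SecondDual A) (SecondDual A) :=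
  ⟨fun c F G => ((arensFirst A F).map_smul c G).symm⟩

end Instances

/-- The canonical embedding `A → A**`. -/
def incl (A : Type*) [NonUnitalNormedRing A] [NormedSpace ℂ A] : A →L[ℂ] SecondDual A :=
  NormedSpace.inclusionInDoubleDual ℂ A

/-- The second adjoint `φ** : A** → B**`, given by `φ**(F)(g) = F (g ∘ φ)`. -/
def secondAdjoint {A B : Type*} [NonUnitalNormedRing A] [NormedSpace ℂ A]
    [NonUnitalNormedRing B] [NormedSpace ℂ B] (φ : A →L[ℂ] B) : SecondDual A →L[ℂ] SecondDual B :=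
  precomp ℂ (precomp ℂ φ)

end SecondDual

/-- A linear map is an `n`-homomorphism if `φ (a₁ ⋯ aₙ) = φ a₁ ⋯ φ aₙ` for all `a₁, …, aₙ`. As the
algebras need not be unital, the (nonempty) product is written with its first factor `a = a₁` and
the list `l = [a₂, …, aₙ]` of the remaining ones. -/
def IsNHomomorphism (n : ℕ) {A B : Type*} [NonUnitalRing A] [Module ℂ A] [NonUnitalRing B]
    [Module ℂ B] (φ : A →ₗ[ℂ] B) : Prop :=
  ∀ (a : A) (l : List A), l.length + 1 = n →
    φ (l.foldl (· * ·) a) = (l.map φ).foldl (· * ·) (φ a)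

/-- `A` has a bounded (two-sided) approximate identity. -/
def HasBoundedApproximateIdentity (A : Type*) [NonUnitalNormedRing A] : Prop :=
  ∃ l : Filter A, l.IsApproximateUnit ∧ ∃ C : ℝ, ∀ᶠ e in l, ‖e‖ ≤ C

end

/-! The Arens product acts by evaluating its left factor last, so the identity defining an
n-homomorphism passes to second duals by peeling off one left factor at a time
(`foldl_mul_apply_eq`). A weak* limit of the approximate identity is a right unit for the first
Arens product and a left unit for the second; regularity makes it a two-sided unit E. The rest is
algebra for T = φ** and u = T E. Filling n - 2 = k slots with E gives T(xy) = T x T y u^k. Hence T x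
= u (T x u^k), and u commutes with the range of T, so ψ x = T x u^k is multiplicative. Since B**
need not have a unit, u^k is always the k-th iterate of right multiplication by u. -/

namespace List

/-- A left fold of a product over `k` copies of `e` is the `k`-th power of right multiplication
by `e`. -/
theorem foldl_mul_replicate {R S : Type*} [CommSemiring R] [NonUnitalSemiring S] [Module R S]
    [IsScalarTower R S S] (e : S) (k : ℕ) (x : S) :
    (replicate k e).foldl (· * ·) x = ((LinearMap.mulRight R e) ^ k) x := by
  induction k generalizing x with
  | zero => rfl
  | succ k ih => rw [replicate_succ, foldl_cons, ih, pow_succ]; rfl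

theorem foldl_mul_replicate_of_mul_eq_self {S : Type*} [Mul S] {e : S}
    (he : ∀ x : S, x * e = x) (k : ℕ) (x : S) : (replicate k e).foldl (· * ·) x = x := by
  induction k with
  | zero => rfl
  | succ k ih => rw [replicate_succ, foldl_cons, he, ih]

end List

namespace LinearMap

variable {R S : Type*} [CommSemiring R] [NonUnitalSemiring S] [Module R S] [IsScalarTower R S S]

theorem pow_mulRight_mul (a x y : S) (j : ℕ) :
    (mulRight R a ^ j) (x * y) = x * (mulRight R a ^ j) y := by
  induction j generalizing y with
  | zero => rfl
  | succ j ih =>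
    rw [pow_succ, Module.End.mul_apply, Module.End.mul_apply, mulRight_apply,
      mulRight_apply, mul_assoc, ih]

theorem pow_mulRight_mul_of_comm {a y : S} (h : a * y = y * a) (x : S) (j : ℕ) :
    (mulRight R a ^ j) x * y = (mulRight R a ^ j) (x * y) := by
  induction j generalizing x with
  | zero => rfl
  | succ j ih =>
    rw [pow_succ, Module.End.mul_apply, Module.End.mul_apply, mulRight_apply,
      mulRight_apply, ih, mul_assoc, h, mul_assoc]

end LinearMap

namespace IsNHomomorphism

variable {R S : Type*} [NonUnitalRing R] [Module ℂ R] [NonUnitalRing S] [Module ℂ S]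
  [IsScalarTower ℂ S S] {k : ℕ} {T : R →ₗ[ℂ] S} {e : R}

/-- Pad the product x y on the right with k copies of e, which leave it unchanged. -/
theorem map_mul_eq_pow_mulRight (hT : IsNHomomorphism (k + 2) T) (he : ∀ x : R, x * e = x)
    (x y : R) : T (x * y) = (LinearMap.mulRight ℂ (T e) ^ k) (T x * T y) := by
  have h := hT x (y :: List.replicate k e) (by simp)
  rwa [List.foldl_cons, List.foldl_mul_replicate_of_mul_eq_self he, List.map_cons,
    List.map_replicate, List.foldl_cons, List.foldl_mul_replicate (R := ℂ)] at h

theorem map_eq_mul_pow_mulRight (hT : IsNHomomorphism (k + 2) T)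
    (he : ∀ x : R, e * x = x ∧ x * e = x) (x : R) :
    T x = T e * (LinearMap.mulRight ℂ (T e) ^ k) (T x) := by
  rw [← LinearMap.pow_mulRight_mul, ← hT.map_mul_eq_pow_mulRight (fun x => (he x).2), (he x).1]

/-- With u = T e, the unit laws give both T x = u T x u^k and T x = T x u^(k+1), so u T x = u T x
u^(k+1) = T x u. -/
theorem map_unit_mul_comm (hT : IsNHomomorphism (k + 2) T)
    (he : ∀ x : R, e * x = x ∧ x * e = x) (x : R) : T e * T x = T x * T e := by
  have h₁ := hT.map_eq_mul_pow_mulRight he x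
  have h₂ := hT.map_mul_eq_pow_mulRight (fun x => (he x).2) x e
  rw [(he x).2] at h₂
  have h₃ : (LinearMap.mulRight ℂ (T e) ^ k) (T x * T e) =
      (LinearMap.mulRight ℂ (T e) ^ k) (T x) * T e := (LinearMap.pow_mulRight_mul_of_comm rfl _ _).symm
  calc T e * T x = T e * (LinearMap.mulRight ℂ (T e) ^ k) (T x) * T e := by
        rw [mul_assoc, ← h₃, ← h₂]
    _ = T x * T e := by rw [← h₁]

/-- For an `n`-homomorphism `T` on an algebra with identity `e`, the homomorphism
`x ↦ T x * (T e) ^ (n - 2)`. -/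
noncomputable def toNonUnitalAlgHom (hT : IsNHomomorphism (k + 2) T)
    (he : ∀ x : R, e * x = x ∧ x * e = x) : R →ₙₐ[ℂ] S where
  toFun x := (LinearMap.mulRight ℂ (T e) ^ k) (T x)
  map_smul' c x := by simp
  map_zero' := by simp
  map_add' x y := by simp
  map_mul' x y := by
    -- Both sides become T x T y u^k u^k; commutation moves the inner u^k past T y.
    rw [hT.map_mul_eq_pow_mulRight fun x => (he x).2, ← LinearMap.pow_mulRight_mul,
      LinearMap.pow_mulRight_mul_of_comm (hT.map_unit_mul_comm he y)]

end IsNHomomorphism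

namespace SecondDual

variable {A B : Type*}
  [NonUnitalNormedRing A] [NormedSpace ℂ A] [IsScalarTower ℂ A A] [SMulCommClass ℂ A A]
  [NonUnitalNormedRing B] [NormedSpace ℂ B] [IsScalarTower ℂ B B] [SMulCommClass ℂ B B]

/-- An element of `A**` as a functional on `A*`. -/
def toStrongDual {A : Type*} [NonUnitalNormedRing A] [NormedSpace ℂ A] (F : SecondDual A) :
    StrongDual ℂ (StrongDual ℂ A) := F

/-- If `f (a₁ ⋯ aₙ) = g (φ a₁ ⋯ φ aₙ)` on `A`, then
`(F₁ ⋯ Fₙ) f = (φ** F₁ ⋯ φ** Fₙ) g` on `A**`. -/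
theorem foldl_mul_apply_eq (φ : A →L[ℂ] B) (l : List (SecondDual A)) (F : SecondDual A)
    (f : StrongDual ℂ A) (g : StrongDual ℂ B)
    (h : ∀ (a : A) (m : List A), m.length = l.length →
      f (m.foldl (· * ·) a) = g ((m.map φ).foldl (· * ·) (φ a))) :
    toStrongDual (l.foldl (· * ·) F) f =
      toStrongDual ((l.map (secondAdjoint φ)).foldl (· * ·) (secondAdjoint φ F)) g := by
  induction l generalizing F f g with
  | nil => exact congrArg (toStrongDual F) (ContinuousLinearMap.ext fun a => h a [] rfl)
  | cons G l ih =>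
    -- Reassociating isolates F as the left factor, so it is enough to compare the functionals on A
    -- to which F is applied.
    rw [List.map_cons, List.foldl_cons, List.foldl_cons, List.foldl_assoc, List.foldl_assoc]
    refine congrArg (toStrongDual F) (ContinuousLinearMap.ext fun a => ?_)
    -- The pair f·a, g·φ(a) satisfies the hypothesis with one factor fewer, which is why f and g
    -- must vary in the induction.
    refine ih G (arensAdjoint (ContinuousLinearMap.mul ℂ A) f a)
      (arensAdjoint (ContinuousLinearMap.mul ℂ B) g (φ a)) fun b m hm => ?_
    have := h a (b :: m) (by simp [hm])
    rwa [List.map_cons, List.foldl_cons, List.foldl_cons, List.foldl_assoc,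
      List.foldl_assoc] at this

theorem isNHomomorphism_secondAdjoint {n : ℕ} {φ : A →L[ℂ] B}
    (hφ : IsNHomomorphism n (φ : A →ₗ[ℂ] B)) :
    IsNHomomorphism n (secondAdjoint φ : SecondDual A →ₗ[ℂ] SecondDual B) := fun F l hl =>
  ContinuousLinearMap.ext fun g => foldl_mul_apply_eq φ l F (g.comp φ) g fun a m hm =>
    congrArg g (hφ a m (by rw [hm, hl]))

/-- A bounded family has a weak* limit in the second dual along an ultrafilter. -/
theorem exists_tendsto_of_eventually_norm_le {E : Type*} [NormedAddCommGroup E] [NormedSpace ℂ E]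
    (U : Ultrafilter E) {C : ℝ} (hC : ∀ᶠ e in (U : Filter E), ‖e‖ ≤ C) :
    ∃ Φ : StrongDual ℂ (StrongDual ℂ E),
      ∀ f : StrongDual ℂ E, Filter.Tendsto (fun e => f e) U (nhds (Φ f)) := by
  let j : E → WeakDual ℂ (StrongDual ℂ E) := fun e =>
    StrongDual.toWeakDual (NormedSpace.inclusionInDoubleDual ℂ E e)
  obtain ⟨Φ, -, hΦ⟩ := (WeakDual.isCompact_closedBall
    (0 : StrongDual ℂ (StrongDual ℂ E)) C).ultrafilter_le_nhds (U.map j) (by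
      rw [Filter.le_principal_iff, Ultrafilter.coe_map, Filter.mem_map]
      filter_upwards [hC] with e he
      simpa [j] using (NormedSpace.double_dual_bound ℂ E e).trans he)
  refine ⟨WeakDual.toStrongDual Φ, fun f => ?_⟩
  exact ((WeakDual.eval_continuous f).tendsto Φ).comp hΦ

theorem exists_identity (hreg : ArensRegular A) (h : HasBoundedApproximateIdentity A) :
    ∃ E : SecondDual A, ∀ F : SecondDual A, E * F = F ∧ F * E = F := by
  obtain ⟨l, hl, C, hC⟩ := h
  have := hl.neBot
  have hU := Ultrafilter.of_le l
  obtain ⟨E, hE⟩ := exists_tendsto_of_eventually_norm_le (Ultrafilter.of l) (hU hC)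
  refine ⟨E, fun F => ⟨(hreg E F).trans ?_, ?_⟩⟩
  -- In the second product, (f·E)(a) = E(a·f) = lim f(ea) = f(a).
  · refine ContinuousLinearMap.ext fun f =>
      congrArg (toStrongDual F) (ContinuousLinearMap.ext fun a => ?_)
    refine tendsto_nhds_unique
      (hE (arensAdjoint (ContinuousLinearMap.mul ℂ A).flip f a)) ?_
    exact (f.continuous.tendsto a).comp ((hl.tendsto_mul_right a).mono_left hU)
  -- In the first product, (E·f)(a) = E(f·a) = lim f(ae) = f(a); no regularity is needed here.
  · refine ContinuousLinearMap.ext fun f =>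
      congrArg (toStrongDual F) (ContinuousLinearMap.ext fun a => ?_)
    refine tendsto_nhds_unique (hE (arensAdjoint (ContinuousLinearMap.mul ℂ A) f a)) ?_
    exact (f.continuous.tendsto a).comp ((hl.tendsto_mul_left a).mono_left hU)

end SecondDual

theorem theorem5p1 {A B : Type*}
    [NonUnitalNormedRing A] [NormedSpace ℂ A] [IsScalarTower ℂ A A] [SMulCommClass ℂ A A]
    [CompleteSpace A]
    [NonUnitalNormedRing B] [NormedSpace ℂ B] [IsScalarTower ℂ B B] [SMulCommClass ℂ B B]
    [CompleteSpace B]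
    (n : ℕ) (hn : 2 ≤ n) (φ : A →L[ℂ] B) (hφ : IsNHomomorphism n (φ : A →ₗ[ℂ] B)) :
    IsNHomomorphism n (SecondDual.secondAdjoint φ : SecondDual A →ₗ[ℂ] SecondDual B) ∧
    (ArensRegular A → HasBoundedApproximateIdentity A →
      ∃ E : SecondDual A, (∀ F : SecondDual A, E * F = F ∧ F * E = F) ∧
        ∃ ψ : SecondDual A →ₙₐ[ℂ] SecondDual B,
          (∀ F : SecondDual A,
            SecondDual.secondAdjoint φ F = SecondDual.secondAdjoint φ E * ψ F) ∧
          ∀ a : A, SecondDual.incl B (φ a) =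
            SecondDual.secondAdjoint φ E * ψ (SecondDual.incl A a)) := by
  have hφ' := SecondDual.isNHomomorphism_secondAdjoint hφ
  refine ⟨hφ', fun hreg hbai => ?_⟩
  obtain ⟨E, hE⟩ := SecondDual.exists_identity hreg hbai
  obtain ⟨k, rfl⟩ := Nat.exists_eq_add_of_le' hn
  exact ⟨E, hE, hφ'.toNonUnitalAlgHom hE, hφ'.map_eq_mul_pow_mulRight hE,
    -- The equality of i_B(φ a) and φ**(i_A a) holds by definition.
    fun a => hφ'.map_eq_mul_pow_mulRight hE (SecondDual.incl A a)⟩
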